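/- Let $p$ be a closed polyhedral curve in $\mathbb R^3$ with vertices $V_0,\dots,V_{n-1}$, $n\ge 3$ (indices modulo $n$), no three consecutive vertices being collinear. Let $c_i=V_i-V_{i-1}$, let $\lambda_i\in(0,\pi)$ be the angle between $c_i$ and $c_{i+1}$, and let $\tau_i\in(-\pi,\pi]$ be the torsion angle of $p$ at the edge $V_{i-1}V_i$, that is, the rotation angle about $c_i$ from the plane $[V_{i-2},V_{i-1},V_i]$ to the plane $[V_{i-1},V_i,V_{i+1}]$. A Kokotsakis belt with planar faces around $p$ is given by spherical four-bars with bar lengths $\gamma_i,\delta_i,\lambda_i,\mu_i$ at the vertices $V_i$ ($\pi$ minus the face angles at $V_i$): a configuration consists of a plane through each edge of $p$, carrying the line $A_i$ through $V_i$ at angle $\gamma_i$ to $c_i$ and the line $B_{i-1}$ through $V_{i-1}$ at angle $\delta_{i-1}$ to $c_i$, such that $A_i$ and $B_i$ enclose the angle $\mu_i$ at every $V_i$; the half-planes at the edge $V_{i-1}V_i$ that contain $A_i$ and $B_{i-1}$ enclose a fixed angle $\zeta_i\in\{0,\pi\}$. The belt is continuously flexible if it admits a non-constant continuous motion with $p$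 fixed. It is of the isogonal type if at every vertex either (1) $\mu_i=\lambda_i$, $\gamma_i=\delta_i$, or (2) $\lambda_i+\mu_i=\pi$, $\gamma_i+\delta_i=\pi$; degenerate isograms ($\delta_i\in\{0,\pi\}$, $\delta_i=\pm\lambda_i$, $\delta_i=\pm(\pi-\lambda_i)$ modulo $2\pi$) are excluded. Belts and motions are taken over $\mathbb C$: the half-angle tangents $\tan\frac{\gamma_i}2,\tan\frac{\delta_i}2,\tan\frac{\mu_i}2$ are arbitrary complex numbers, the equations of a configuration are written polynomially in them, and dimension is that of the Zariski closure in the space $\mathbb C^{3n}$ of these parameters. (a) If $n>3$, the set of continuously flexible Kokotsakis belts of the isogonal type with planar faces around $p$ has dimension at least $n-3$ over $\mathbb C$. (b) If $p$ is planar (always the case for $n=3$), this set has dimension at least $n-1$. More precisely, the zero-shift choice $\zeta_i=\tau_i$ (that is, $\varepsilon_i=\zeta_i-\tau_i=0$ and $e_i=\tan\frac{\varepsilon_i}2=0$) is possible for all $i$. With this choice every belt with isograms of type (1) that has transmission ratios $f_i=\frac{\sin\delta_i\pm\sin\lambda_i}{\sin(\delta_i-\lambda_i)}$ with $f_0f_1\cdots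 f_{n-1}=1$ (for some choice of the signs; $f_i$ is understood as a rational function of $\tan\frac{\delta_i}2$ and $\tan\frac{\lambda_i}2$) is continuously flexible, and these belts form a set of dimension at least $n-1$. -/

import Mathlib

open scoped Matrix

namespace Kokotsakis

/-- A closed polyhedral curve with vertices `V 0, …, V (n-1)` (indices modulo `n`): no three
consecutive vertices are collinear, i.e. all polygon angles lie strictly between `0` and `π`. -/
def IsPolyhedralCurve {n : ℕ} [NeZero n] (V : Fin n → EuclideanSpace ℝ (Fin 3)) : Prop :=
  ∀ i : Fin n, ¬ Collinear ℝ {V (i - 1), V i, V (i + 1)}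

/-- The edge vector `c i` from `V (i-1)` to `V i`. -/
noncomputable def edge {n : ℕ} [NeZero n] (V : Fin n → EuclideanSpace ℝ (Fin 3)) (i : Fin n) :
    EuclideanSpace ℝ (Fin 3) :=
  V i - V (i - 1)

/-- The unit vector `C i` of the `i`-th edge, seen in `ℂ³`. -/
noncomputable def edgeDir {n : ℕ} [NeZero n] (V : Fin n → EuclideanSpace ℝ (Fin 3)) (i : Fin n) :
    Fin 3 → ℂ :=
  fun j => ((‖edge V i‖⁻¹ * edge V i j : ℝ) : ℂ)

/-- The spherical bar length `λ i`: the angle between the consecutive oriented edges `c i` and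
`c (i+1)`, which is `π` minus the interior angle of the polygon at `V i`. -/
noncomputable def barLambda {n : ℕ} [NeZero n] (V : Fin n → EuclideanSpace ℝ (Fin 3)) (i : Fin n) :
    ℝ :=
  InnerProductGeometry.angle (edge V i) (edge V (i + 1))

/-- `tan (λ i / 2)`, as a complex number. -/
noncomputable def tanLambda {n : ℕ} [NeZero n] (V : Fin n → EuclideanSpace ℝ (Fin 3)) (i : Fin n) :
    ℂ :=
  ((Real.tan (barLambda V i / 2) : ℝ) : ℂ)

/-- The complex parameters of a belt with planar faces around a given curve: at each vertex `i`
the half-angle tangents of the three remaining spherical bar lengths `γ i`, `δ i`, `μ i`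
(`π` minus the face angles at `V i`).  Real angles in `(0, π)` correspond to positive real
parameters. -/
abbrev BeltParam (n : ℕ) : Type := Fin n × Fin 3 → ℂ

/-- `tan (γ i / 2)`. -/
def BeltParam.g {n : ℕ} (x : BeltParam n) (i : Fin n) : ℂ := x (i, 0)

/-- `tan (δ i / 2)`. -/
def BeltParam.d {n : ℕ} (x : BeltParam n) (i : Fin n) : ℂ := x (i, 1)

/-- `tan (μ i / 2)`. -/
def BeltParam.m {n : ℕ} (x : BeltParam n) (i : Fin n) : ℂ := x (i, 2)

/-- The oriented belt line `A i` at `V i` that lies in the face through the edge `V (i-1) V i`,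
scaled by `1 + g²`: it equals `(1 + g²) (cos γ • C i + sin γ • u i)`, where the unit vector `u i`,
orthogonal to the edge, determines the plane of that face. -/
noncomputable def armA {n : ℕ} [NeZero n] (V : Fin n → EuclideanSpace ℝ (Fin 3)) (x : BeltParam n)
    (u : Fin n → Fin 3 → ℂ) (i : Fin n) : Fin 3 → ℂ :=
  (1 - x.g i ^ 2) • edgeDir V i + (2 * x.g i) • u i

/-- The oriented belt line `B i` at `V i` that lies in the face through the edge `V i V (i+1)`,
scaled by `1 + d²`.  Since this face is planar and also contains `A (i+1)`, the half-planes at this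
edge containing `B i` and `A (i+1)` coincide (`ζ (i+1) = 1`, angle `0`) or are opposite
(`ζ (i+1) = -1`, angle `π`). -/
noncomputable def armB {n : ℕ} [NeZero n] (V : Fin n → EuclideanSpace ℝ (Fin 3)) (x : BeltParam n)
    (ζ : Fin n → ℤˣ) (u : Fin n → Fin 3 → ℂ) (i : Fin n) : Fin 3 → ℂ :=
  (1 - x.d i ^ 2) • edgeDir V (i + 1) + (2 * x.d i * ((ζ (i + 1) : ℤ) : ℂ)) • u (i + 1)

/-- `u` is a configuration of the belt with planar faces around the fixed curve: every `u i` is a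
unit vector orthogonal to the `i`-th edge, and the angle between `A i` and `B i` is `μ i`
(with the denominators of the half-angle substitution cleared). -/
structure IsConfiguration {n : ℕ} [NeZero n] (V : Fin n → EuclideanSpace ℝ (Fin 3))
    (x : BeltParam n) (ζ : Fin n → ℤˣ) (u : Fin n → Fin 3 → ℂ) : Prop where
  unit : ∀ i, u i ⬝ᵥ u i = 1
  orth : ∀ i, u i ⬝ᵥ edgeDir V i = 0
  angle_mu : ∀ i, (1 + x.m i ^ 2) * (armA V x u i ⬝ᵥ armB V x ζ u i) =
    (1 - x.m i ^ 2) * ((1 + x.g i ^ 2) * (1 + x.d i ^ 2))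

/-- Continuous flexibility: a non-constant continuous motion through configurations, the curve
being kept fixed. -/
def IsFlexible {n : ℕ} [NeZero n] (V : Fin n → EuclideanSpace ℝ (Fin 3)) (x : BeltParam n)
    (ζ : Fin n → ℤˣ) : Prop :=
  ∃ u : ℝ → Fin n → Fin 3 → ℂ, ContinuousOn u (Set.Icc 0 1) ∧
    (∀ t ∈ Set.Icc (0 : ℝ) 1, IsConfiguration V x ζ (u t)) ∧ u 0 ≠ u 1

/-- Isogram of type (1) at vertex `i`: `μ = λ` and `γ = δ`. -/
def IsType1At {n : ℕ} [NeZero n] (V : Fin n → EuclideanSpace ℝ (Fin 3)) (x : BeltParam n)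
    (i : Fin n) : Prop :=
  x.m i = tanLambda V i ∧ x.g i = x.d i

/-- Isogram of type (2) at vertex `i`: `λ + μ = π` and `δ + γ = π`. -/
def IsType2At {n : ℕ} [NeZero n] (V : Fin n → EuclideanSpace ℝ (Fin 3)) (x : BeltParam n)
    (i : Fin n) : Prop :=
  tanLambda V i * x.m i = 1 ∧ x.d i * x.g i = 1

/-- The isograms are not degenerate: `δ ∉ {0, π}`, `δ ≠ ±λ` and `δ ≠ ±(π - λ)` modulo `2π`. -/
def IsNondegenerate {n : ℕ} [NeZero n] (V : Fin n → EuclideanSpace ℝ (Fin 3)) (x : BeltParam n) :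
    Prop :=
  ∀ i, x.d i ≠ 0 ∧ x.d i ^ 2 ≠ tanLambda V i ^ 2 ∧ x.d i ^ 2 * tanLambda V i ^ 2 ≠ 1

/-- The set, over `ℂ`, of the continuously flexible Kokotsakis belts of the isogonal type with
planar faces around the polyhedral curve `V`. -/
def flexibleIsogonalBelts {n : ℕ} [NeZero n] (V : Fin n → EuclideanSpace ℝ (Fin 3)) :
    Set (BeltParam n) :=
  {x | (∀ i, IsType1At V x i ∨ IsType2At V x i) ∧ IsNondegenerate V x ∧ ∃ ζ, IsFlexible V x ζ}

/-- The shifts `ε i = ζ i - τ i` all vanish, where `τ i` is the torsion angle of the curve at its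
`i`-th edge: `τ i` is `0` or `π` (the edges `i-1`, `i`, `i+1` are linearly dependent), it is `0`
where `ζ i = 1`, and it is `π` where `ζ i = -1`. -/
def ZeroShifts {n : ℕ} [NeZero n] (V : Fin n → EuclideanSpace ℝ (Fin 3)) (ζ : Fin n → ℤˣ) : Prop :=
  ∀ i, ((edge V (i - 1)).ofLp ⨯₃ (edge V i).ofLp) ⬝ᵥ (edge V (i + 1)).ofLp = 0 ∧
    0 < ((ζ i : ℤ) : ℝ) * (((edge V (i - 1)).ofLp ⨯₃ (edge V i).ofLp) ⬝ᵥ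
      ((edge V i).ofLp ⨯₃ (edge V (i + 1)).ofLp))

/-- `f` is one of the two transmission ratios `(sin δ ± sin λ) / sin (δ - λ)` of an isogram of
type (1), written in `d = tan (δ / 2)` and `l = tan (λ / 2)`. -/
def IsTransmissionRatio (l d f : ℂ) : Prop :=
  f = (d + l) / (d - l) ∨ f = (1 - d * l) / (1 + d * l)

/-- The non-degenerate belts with isograms of type (1) which have transmission ratios
`f 0, …, f (n-1)` with product `1`. -/
def productOneBelts {n : ℕ} [NeZero n] (V : Fin n → EuclideanSpace ℝ (Fin 3)) :
    Set (BeltParam n) :=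
  {x | (∀ i, IsType1At V x i) ∧ IsNondegenerate V x ∧
    ∃ f : Fin n → ℂ, (∀ i, IsTransmissionRatio (tanLambda V i) (x.d i) (f i)) ∧ ∏ i, f i = 1}

/-- The dimension of a set of points of affine space over `ℂ`: the Krull dimension of the
coordinate ring of its Zariski closure (`⊥` for the empty set). -/
noncomputable def algDim {σ : Type*} (S : Set (σ → ℂ)) : WithBot ℕ∞ :=
  ringKrullDim (MvPolynomial σ ℂ ⧸ MvPolynomial.vanishingIdeal ℂ S)

end Kokotsakis

namespace Kokotsakis

open MvPolynomial

/-! ### Lower bounds for dimensions of algebraic sets. -/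

section Dimension

variable {σ τ : Type*}

/-! Only isograms of type (1) are used: such a belt is determined by `d i = tan (δ i / 2)`, giving
`n` free parameters. By Krull's height theorem, `k` polynomial equations in `d` cut out a set of
dimension at least `n - k` as soon as one nondegenerate solution exists (`le_algDim_of_mem`,
`le_algDim_of_belts`). Both bounds thus need few equations that force flexibility, and one explicit
complex solution.

For a general curve, encode the face at an edge with direction `C` by the isotropic direction `C + i
u`. In these terms an isogram is the rotation about the binormal given by the quaternion `a + b W`
with `a = D + l ^ 2`, `b = l (D - 1)`, `d = i D` (`IsJoint.isogram_of_isotropic`). The belt flexes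
if the product of these quaternions around the curve is scalar: three equations
(`IsPolyhedralCurve.isFlexible_of_scalar`). At `d = i` every factor is already scalar, whence `n -
3`.

For a planar curve all binormals agree up to sign, and zero shifts absorb the signs. Measured from
the common plane, the half-angle tangent of the face angle is multiplied by `f i` at each vertex
(`IsJoint.isogram_of_ratio`), so `∏ f i = 1` closes the motion: one equation, whence `n - 1`. -/

lemma card_le_height_vanishingIdeal_singleton [Finite σ] (x : σ → ℂ) :
    (Nat.card σ : ℕ∞) ≤ (vanishingIdeal ℂ {x} : Ideal (MvPolynomial σ ℂ)).height := by
  have hdim : ringKrullDim (MvPolynomial σ ℂ) ≤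
      ((vanishingIdeal ℂ {x} : Ideal (MvPolynomial σ ℂ)).height : WithBot ℕ∞) := by
    rw [ringKrullDim_le_iff_isMaximal_height_le]
    intro m hm
    obtain ⟨y, rfl⟩ := eq_vanishingIdeal_singleton_of_isMaximal ℂ hm
    -- Maximal ideals are points over `ℂ`; the translation from `x` to `y` shows that all have the
    -- same height, which is then the Krull dimension.
    let e : MvPolynomial σ ℂ ≃ₐ[ℂ] MvPolynomial σ ℂ := AlgEquiv.ofAlgHom
      (aeval fun i => X i + C (y i - x i)) (aeval fun i => X i - C (y i - x i))
      (by ext i; simp) (by ext i; simp)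
    have he : (vanishingIdeal ℂ {x}).comap e.toRingEquiv = vanishingIdeal ℂ {y} := by
      ext p
      have : aeval x (e p) = aeval y p := by
        change ((aeval x).comp e.toAlgHom) p = aeval y p
        congr 1
        ext i
        simp [e]
      rw [Ideal.mem_comap, mem_vanishingIdeal_singleton_iff, mem_vanishingIdeal_singleton_iff, ← this]
      rfl
    rw [← he, RingEquiv.height_comap]
  rw [MvPolynomial.ringKrullDim_of_isNoetherianRing, ringKrullDim_eq_zero_of_field, zero_add] at hdim
  exact_mod_cast hdim

lemma algDim_mono {S T : Set (σ → ℂ)} (h : S ⊆ T) : algDim S ≤ algDim T :=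
  ringKrullDim_le_of_surjective (Ideal.Quotient.factor (vanishingIdeal_anti_mono h))
    (Ideal.Quotient.factor_surjective _)

/-- The dimension does not drop along a polynomial map with a coordinate projection as left
inverse. -/
lemma algDim_le_algDim_image (φ : τ → MvPolynomial σ ℂ) (j : σ → τ) (hj : ∀ i, φ (j i) = X i)
    (T : Set (σ → ℂ)) : algDim T ≤ algDim ((fun x k => aeval x (φ k)) '' T) := by
  -- Substituting `φ` maps coordinate rings onto each other: renaming along `j` supplies preimages.
  refine ringKrullDim_le_of_surjective (Ideal.quotientMap _ (aeval φ : _ →ₐ[ℂ] _).toRingHom ?_)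
    (Ideal.quotientMap_surjective ?_)
  · intro p hp x hx
    have := hp _ ⟨x, hx, rfl⟩
    change aeval x (aeval φ p) = 0
    rw [← this]
    exact (comp_aeval_apply φ (aeval x) p)
  · intro p
    refine ⟨rename j p, ?_⟩
    change aeval φ (rename j p) = p
    rw [aeval_rename]
    have : φ ∘ j = X := funext hj
    simp [this]

/-- At a point of it, the set given by finitely many equations and one inequation has at least
the expected dimension. -/
lemma le_algDim_of_mem [Finite σ] (s : Set (MvPolynomial σ ℂ)) (h : MvPolynomial σ ℂ) (x : σ → ℂ)
    (hs : ∀ p ∈ s, aeval x p = 0) (hx : aeval x h ≠ 0) :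
    (Nat.card σ : WithBot ℕ∞) ≤
      algDim {y : σ → ℂ | (∀ p ∈ s, aeval y p = 0) ∧ aeval y h ≠ 0} + s.encard := by
  set T : Set (σ → ℂ) := {y | (∀ p ∈ s, aeval y p = 0) ∧ aeval y h ≠ 0}
  let m : Ideal (MvPolynomial σ ℂ) := vanishingIdeal ℂ {x}
  have hsm : s ⊆ m := fun p hp => by simpa [m] using hs p hp
  -- Krull: passing to the quotient by `s` lowers the height of the point's ideal by at most the
  -- number of equations.
  have hm := Ideal.height_le_height_add_encard_of_subset s hsm
  have hI : Ideal.span s ≤ m := Ideal.span_le.2 hsm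
  have hprime : (m.map (Ideal.Quotient.mk (Ideal.span s))).IsPrime :=
    Ideal.isPrime_map_quotientMk_of_isPrime hI
  let P : PrimeSpectrum (MvPolynomial σ ℂ ⧸ Ideal.span s) := ⟨_, hprime⟩
  have hT : ∀ q : Ideal (MvPolynomial σ ℂ), q.IsPrime → Ideal.span s ≤ q → q ≤ m →
      vanishingIdeal ℂ T ≤ q := by
    intro q hq hsq hqm p hp
    have hhq : h ∉ q := fun hh => hx (by simpa [m] using hqm hh)
    -- `p * h` vanishes on the whole zero locus of `q`, so the Nullstellensatz puts it into `q`.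
    refine (hq.mem_or_mem (?_ : p * h ∈ q)).resolve_right hhq
    rw [← IsPrime.vanishingIdeal_zeroLocus (K := ℂ) q]
    intro y hy
    by_cases hyh : aeval y h = 0
    · rw [map_mul, hyh, mul_zero]
    · have : aeval y p = 0 := hp y ⟨fun r hr => hy r (hsq (Ideal.subset_span hr)), hyh⟩
      rw [map_mul, this, zero_mul]
  have hdim : ((m.map (Ideal.Quotient.mk (Ideal.span s))).height : WithBot ℕ∞) ≤ algDim T := by
    have h1 : (m.map (Ideal.Quotient.mk (Ideal.span s))).height = Order.height P :=
      P.height_eq_orderHeight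
    rw [h1, Order.height_eq_krullDim_Iic]
    have hcm : P.asIdeal.comap (Ideal.Quotient.mk (Ideal.span s)) = m := by
      simp [P, Ideal.comap_map_of_surjective _ Ideal.Quotient.mk_surjective,
        ← RingHom.ker_eq_comap_bot, hI]
    have hle : ∀ Q : Set.Iic P, vanishingIdeal ℂ T ≤
        Q.1.asIdeal.comap (Ideal.Quotient.mk (Ideal.span s)) := fun Q =>
      hT _ inferInstance
        (fun p hp => by
          rw [Ideal.mem_comap, Ideal.Quotient.eq_zero_iff_mem.2 hp]; exact zero_mem _)
        ((Ideal.comap_mono Q.2).trans hcm.le)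
    have hsurj := Ideal.Quotient.mk_surjective (I := vanishingIdeal ℂ T)
    -- Primes below the point contain the vanishing ideal of `T`, so chains of them survive in its
    -- coordinate ring.
    refine Order.krullDim_le_of_strictMono
      (fun Q => ⟨(Q.1.asIdeal.comap (Ideal.Quotient.mk (Ideal.span s))).map
        (Ideal.Quotient.mk (vanishingIdeal ℂ T)),
        Ideal.isPrime_map_quotientMk_of_isPrime (hle Q)⟩) ?_
    refine Monotone.strictMono_of_injective
      (fun Q Q' hQ => Ideal.map_mono (Ideal.comap_mono hQ)) (fun Q Q' hQ => ?_)
    have hQ' := congrArg (fun R => R.asIdeal.comap (Ideal.Quotient.mk (vanishingIdeal ℂ T))) hQ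
    simp only [Ideal.comap_map_of_surjective _ hsurj, ← RingHom.ker_eq_comap_bot,
      Ideal.mk_ker, sup_of_le_left (hle _)] at hQ'
    exact Subtype.ext (PrimeSpectrum.ext
      (Ideal.comap_injective_of_surjective _ Ideal.Quotient.mk_surjective hQ'))
  have h0 := (card_le_height_vanishingIdeal_singleton x).trans hm
  calc (Nat.card σ : WithBot ℕ∞) ≤
      (((m.map (Ideal.Quotient.mk (Ideal.span s))).height + s.encard : ℕ∞) : WithBot ℕ∞) := by
        exact_mod_cast h0
    _ ≤ _ := by push_cast; gcongr

end Dimension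

/-! ### A single isogram in `ℂ³`. -/

section VectorAlgebra

/-- `C` and `C'` are unit vectors, `W` is their unit binormal, and `C'` arises from `C` by the
rotation about `W` with half-angle tangent `l`. -/
structure IsJoint (C C' W : Fin 3 → ℂ) (l : ℂ) : Prop where
  unit : C ⬝ᵥ C = 1
  unit_binormal : W ⬝ᵥ W = 1
  orth : W ⬝ᵥ C = 0
  ne : 1 + l ^ 2 ≠ 0
  rotate : (1 + l ^ 2) • C' = (1 - l ^ 2) • C + (2 * l) • (W ⨯₃ C)

variable {C C' W : Fin 3 → ℂ} {l : ℂ}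

lemma cross_cross_of_orth (hW : W ⬝ᵥ W = 1) (h : W ⬝ᵥ C = 0) : W ⨯₃ (W ⨯₃ C) = -C := by
  ext j
  simp only [dotProduct, Fin.sum_univ_three] at hW h
  fin_cases j <;> simp [cross_apply]
  · linear_combination W 0 * h - C 0 * hW
  · linear_combination W 1 * h - C 1 * hW
  · linear_combination W 2 * h - C 2 * hW

lemma cross_dot_cross_of_orth (hC : C ⬝ᵥ C = 1) (hW : W ⬝ᵥ W = 1) (h : W ⬝ᵥ C = 0) :
    (W ⨯₃ C) ⬝ᵥ (W ⨯₃ C) = 1 := by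
  rw [cross_dot_cross, hC, hW, h, dotProduct_comm C W, h]
  ring

/-- The bilinear form on `ℂ³` is not definite, so completeness of the orthonormal frame comes from
`A * Aᵀ = 1` implying `Aᵀ * A = 1`. -/
lemma frame_expansion (hC : C ⬝ᵥ C = 1) (hW : W ⬝ᵥ W = 1) (h : W ⬝ᵥ C = 0) (N : Fin 3 → ℂ) :
    N = (N ⬝ᵥ C) • C + (N ⬝ᵥ (W ⨯₃ C)) • (W ⨯₃ C) + (N ⬝ᵥ W) • W := by
  have hP := cross_dot_cross_of_orth hC hW h
  have hPC : (W ⨯₃ C) ⬝ᵥ C = 0 := by rw [dotProduct_comm, dot_cross_self]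
  have hPW : (W ⨯₃ C) ⬝ᵥ W = 0 := by rw [dotProduct_comm, dot_self_cross]
  let A : Matrix (Fin 3) (Fin 3) ℂ := Matrix.of ![C, W ⨯₃ C, W]
  have h0 : A 0 = C := rfl
  have h1 : A 1 = W ⨯₃ C := rfl
  have h2 : A 2 = W := rfl
  have hA : A * Aᵀ = 1 := by
    ext i j
    rw [Matrix.mul_apply']
    change A i ⬝ᵥ A j = _
    fin_cases i <;> fin_cases j <;>
      simp [h0, h1, h2, hC, hW, h, hP, hPC, hPW, dotProduct_comm C W]
  have hA' : Aᵀ * A = 1 := mul_eq_one_comm.1 hA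
  have hN : Aᵀ *ᵥ (A *ᵥ N) = N := by rw [Matrix.mulVec_mulVec, hA', Matrix.one_mulVec]
  conv_lhs => rw [← hN]
  ext j
  have hr : ∀ i, (A *ᵥ N) i = N ⬝ᵥ A i := fun i => dotProduct_comm _ _
  rw [Matrix.mulVec, dotProduct, Fin.sum_univ_three]
  simp only [hr, Matrix.transpose_apply, h0, h1, h2, Pi.add_apply, Pi.smul_apply, smul_eq_mul]
  ring

/-- The unit vector orthogonal to `C` at the angle with half-angle tangent `s` from `W × C`
towards `W`. -/
noncomputable def turn (C W : Fin 3 → ℂ) (s : ℂ) : Fin 3 → ℂ :=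
  ((1 - s ^ 2) / (1 + s ^ 2)) • (W ⨯₃ C) + (2 * s / (1 + s ^ 2)) • W

lemma turn_dot_self (hC : C ⬝ᵥ C = 1) (hW : W ⬝ᵥ W = 1) (h : W ⬝ᵥ C = 0) {s : ℂ}
    (hs : 1 + s ^ 2 ≠ 0) : turn C W s ⬝ᵥ turn C W s = 1 := by
  have hP := cross_dot_cross_of_orth hC hW h
  have hPW : (W ⨯₃ C) ⬝ᵥ W = 0 := by rw [dotProduct_comm, dot_self_cross]
  simp only [turn, dotProduct_add, add_dotProduct, smul_dotProduct, dotProduct_smul, hP, hW, hPW,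
    dot_self_cross, smul_eq_mul]
  field_simp
  ring

lemma turn_dot (h : W ⬝ᵥ C = 0) (s : ℂ) : turn C W s ⬝ᵥ C = 0 := by
  have hPC : (W ⨯₃ C) ⬝ᵥ C = 0 := by rw [dotProduct_comm, dot_cross_self]
  simp [turn, h, hPC]

lemma turn_dot_binormal (hW : W ⬝ᵥ W = 1) (s : ℂ) : turn C W s ⬝ᵥ W = 2 * s / (1 + s ^ 2) := by
  have hPW : (W ⨯₃ C) ⬝ᵥ W = 0 := by rw [dotProduct_comm, dot_self_cross]
  simp [turn, hW, hPW]

/-- For `z = -1`: reversing the binormal reverses the vector at the same half-angle tangent. This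
sign is what `ζ` compensates. -/
lemma turn_smul {z : ℂ} (s : ℂ) : turn C (z • W) s = z • turn C W s := by
  simp only [turn, LinearMap.map_smul₂, smul_add, smul_comm z]

namespace IsJoint

lemma eq_rotate (H : IsJoint C C' W l) :
    C' = ((1 - l ^ 2) / (1 + l ^ 2)) • C + (2 * l / (1 + l ^ 2)) • (W ⨯₃ C) := by
  have hl := H.ne
  have : C' = (1 + l ^ 2)⁻¹ • ((1 + l ^ 2) • C') := by rw [smul_smul, inv_mul_cancel₀ hl, one_smul]
  rw [this, H.rotate, smul_add, smul_smul, smul_smul]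
  congr 2 <;> field_simp

/-- Half-angle tangents which are proportional by a transmission ratio satisfy the equation of the
isogram. -/
lemma isogram_of_ratio (H : IsJoint C C' W l) {d f s : ℂ} (hf : IsTransmissionRatio l d f)
    (hd : d ^ 2 ≠ l ^ 2) (hdl : d ^ 2 * l ^ 2 ≠ 1) (hs : 1 + s ^ 2 ≠ 0)
    (hs' : 1 + (f * s) ^ 2 ≠ 0) :
    (1 + l ^ 2) * (((1 - d ^ 2) • C + (2 * d) • turn C W s) ⬝ᵥ
      ((1 - d ^ 2) • C' + (2 * d) • turn C' W (f * s))) = (1 - l ^ 2) * (1 + d ^ 2) ^ 2 := by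
  have hl := H.ne
  have hC := H.unit
  have hW := H.unit_binormal
  have h := H.orth
  have hP := cross_dot_cross_of_orth hC hW h
  have hPW : (W ⨯₃ C) ⬝ᵥ W = 0 := by rw [dotProduct_comm, dot_self_cross]
  have hPC : (W ⨯₃ C) ⬝ᵥ C = 0 := by rw [dotProduct_comm, dot_cross_self]
  have h' : C ⬝ᵥ W = 0 := by rw [dotProduct_comm, h]
  have hWC' : W ⨯₃ C' = ((1 - l ^ 2) / (1 + l ^ 2)) • (W ⨯₃ C) - (2 * l / (1 + l ^ 2)) • C := by
    rw [H.eq_rotate, map_add, map_smul, map_smul, cross_cross_of_orth hW h, smul_neg,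
      ← sub_eq_add_neg]
  have key : (f - (d + l) / (d - l)) * (f - (1 - d * l) / (1 + d * l)) = 0 := by
    rcases hf with rfl | rfl <;> simp
  have h1 : d - l ≠ 0 := fun h => hd (by rw [sub_eq_zero.1 h])
  have h2 : 1 + d * l ≠ 0 := fun h => hdl (by linear_combination (d * l - 1) * h)
  -- The two transmission ratios are the roots of this quadratic; the isogram equation reduces to
  -- it.
  have key' : (d - l) * (1 + d * l) * f ^ 2 - 2 * d * (1 + l ^ 2) * f + (d + l) * (1 - d * l)
      = 0 := by
    field_simp at key
    linear_combination key
  simp only [turn, hWC', dotProduct_add, add_dotProduct, smul_dotProduct, dotProduct_smul,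
    dotProduct_sub, smul_eq_mul]
  rw [H.eq_rotate]
  simp only [dotProduct_add, dotProduct_smul, smul_eq_mul, hC, hW, h, h', hP, hPW, hPC, dot_self_cross, dot_cross_self]
  rw [mul_pow] at hs' ⊢
  rw [mul_comm (f ^ 2)] at hs' ⊢
  field_simp
  linear_combination (-8 * d * s ^ 2) * key'

end IsJoint

/-- The image of `N` under the (scaled) rotation about `W` given by the quaternion `a + b W`. -/
def rot (W : Fin 3 → ℂ) (a b : ℂ) (N : Fin 3 → ℂ) : Fin 3 → ℂ :=
  (a ^ 2 - b ^ 2) • N + (2 * a * b) • (W ⨯₃ N) + (2 * b ^ 2 * (W ⬝ᵥ N)) • W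

/-- The unit vector `u` orthogonal to `C` for which `C + i u` is a multiple of the isotropic
vector `N`. -/
noncomputable def ofIsotropic (C N : Fin 3 → ℂ) : Fin 3 → ℂ :=
  Complex.I • (C - (N ⬝ᵥ C)⁻¹ • N)

lemma ofIsotropic_dot_self (hC : C ⬝ᵥ C = 1) {N : Fin 3 → ℂ} (hN : N ⬝ᵥ N = 0)
    (hNC : N ⬝ᵥ C ≠ 0) : ofIsotropic C N ⬝ᵥ ofIsotropic C N = 1 := by
  simp only [ofIsotropic, smul_dotProduct, dotProduct_smul, sub_dotProduct, dotProduct_sub, hC, hN,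
    dotProduct_comm C N, smul_eq_mul]
  field_simp
  rw [Complex.I_sq]
  ring

lemma ofIsotropic_dot (hC : C ⬝ᵥ C = 1) {N : Fin 3 → ℂ} (hNC : N ⬝ᵥ C ≠ 0) :
    ofIsotropic C N ⬝ᵥ C = 0 := by
  simp [ofIsotropic, smul_dotProduct, sub_dotProduct, hC, hNC]

lemma ofIsotropic_smul (C N : Fin 3 → ℂ) {r : ℂ} (hr : r ≠ 0) :
    ofIsotropic C (r • N) = ofIsotropic C N := by
  simp only [ofIsotropic, smul_dotProduct, smul_smul, smul_eq_mul, mul_inv]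
  rw [mul_right_comm, inv_mul_cancel₀ hr, one_mul]

namespace IsJoint

/-- In terms of isotropic vectors, the isogram rotates the one into the other about the binormal;
this is the identity if `d = i`. -/
lemma isogram_of_isotropic (H : IsJoint C C' W l) {D d : ℂ} (hD : d = Complex.I * D)
    {N N' : Fin 3 → ℂ} (hN' : N' = rot W (D + l ^ 2) (l * (D - 1)) N) (hN : N ⬝ᵥ N = 0)
    (hNC : N ⬝ᵥ C ≠ 0) (hNC' : N' ⬝ᵥ C' ≠ 0) :
    (1 + l ^ 2) * (((1 - d ^ 2) • C + (2 * d) • ofIsotropic C N) ⬝ᵥ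
      ((1 - d ^ 2) • C' + (2 * d) • ofIsotropic C' N')) = (1 - l ^ 2) * (1 + d ^ 2) ^ 2 := by
  have hl := H.ne
  have hC := H.unit
  have hW := H.unit_binormal
  have h := H.orth
  have hP := cross_dot_cross_of_orth hC hW h
  have hPW : (W ⨯₃ C) ⬝ᵥ W = 0 := by rw [dotProduct_comm, dot_self_cross]
  have hPC : (W ⨯₃ C) ⬝ᵥ C = 0 := by rw [dotProduct_comm, dot_cross_self]
  have h' : C ⬝ᵥ W = 0 := by rw [dotProduct_comm, h]
  have hd2 : d ^ 2 = -D ^ 2 := by rw [hD, mul_pow, Complex.I_sq]; ring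
  -- Each arm is a combination of the edge direction and the isotropic vector, with `i` eliminated
  -- through `D`.
  have harm : ∀ E M : Fin 3 → ℂ, (1 - d ^ 2) • E + (2 * d) • ofIsotropic E M =
      (1 - D) ^ 2 • E + (2 * D * (M ⬝ᵥ E)⁻¹) • M := by
    intro E M
    rw [hd2, hD]
    ext j
    simp only [ofIsotropic, Pi.add_apply, Pi.sub_apply, Pi.smul_apply, smul_eq_mul]
    linear_combination (2 * D * (E j - (M ⬝ᵥ E)⁻¹ * M j)) * Complex.I_sq
  set x := N ⬝ᵥ C with hx
  set y := N ⬝ᵥ (W ⨯₃ C) with hy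
  set z := N ⬝ᵥ W with hz
  have hexp : N = x • C + y • (W ⨯₃ C) + z • W := frame_expansion hC hW h N
  have hxyz : x ^ 2 + y ^ 2 + z ^ 2 = 0 := by
    have h0 := hN
    nth_rw 2 [hexp] at h0
    simp only [dotProduct_add, dotProduct_smul, smul_eq_mul, ← hx, ← hy, ← hz] at h0
    linear_combination h0
  set a := D + l ^ 2 with ha
  set b := l * (D - 1) with hb
  have hrot : N' = ((a ^ 2 - b ^ 2) * x - 2 * a * b * y) • C +
      ((a ^ 2 - b ^ 2) * y + 2 * a * b * x) • (W ⨯₃ C) + ((a ^ 2 + b ^ 2) * z) • W := by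
    have hWN : W ⨯₃ N = x • (W ⨯₃ C) - y • C := by
      rw [hexp]
      simp only [map_add, map_smul, cross_self, cross_cross_of_orth hW h]
      simp [sub_eq_add_neg]
    rw [hN', rot, hWN, dotProduct_comm W N, ← hz]
    nth_rw 1 [hexp]
    module
  set x' := (a ^ 2 - b ^ 2) * x - 2 * a * b * y with hx'
  set y' := (a ^ 2 - b ^ 2) * y + 2 * a * b * x with hy'
  have hCC' : C ⬝ᵥ C' = (1 - l ^ 2) / (1 + l ^ 2) := by
    rw [H.eq_rotate]
    simp [hC]
  have hN'C : C ⬝ᵥ N' = x' := by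
    rw [hrot]
    simp [hC, h']
  have hNC'' : N ⬝ᵥ C' = ((1 - l ^ 2) * x + 2 * l * y) / (1 + l ^ 2) := by
    rw [H.eq_rotate]
    simp only [dotProduct_add, dotProduct_smul, smul_eq_mul, ← hx, ← hy]
    ring
  have hX' : N' ⬝ᵥ C' = ((1 - l ^ 2) * x' + 2 * l * y') / (1 + l ^ 2) := by
    rw [H.eq_rotate, hrot]
    simp only [dotProduct_add, add_dotProduct, smul_dotProduct, dotProduct_smul, smul_eq_mul, hC,
      h, hPC, hP, dot_cross_self, dot_self_cross]
    ring
  have hNN' : N ⬝ᵥ N' = x * x' + y * y' + (a ^ 2 + b ^ 2) * z ^ 2 := by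
    rw [hrot]
    simp only [dotProduct_add, dotProduct_smul, smul_eq_mul, ← hx, ← hy, ← hz]
    ring
  rw [harm, harm, hX']
  simp only [dotProduct_add, add_dotProduct, smul_dotProduct, dotProduct_smul, smul_eq_mul, hCC',
    hN'C, hNC'', hNN', hd2, ← hx]
  rw [hX'] at hNC'
  set X' := (1 - l ^ 2) * x' + 2 * l * y' with hX'def
  have hX'0 : X' ≠ 0 := fun h0 => hNC' (by rw [h0, zero_div])
  field_simp
  rw [hX'def, hx', hy', ha, hb]
  -- Isotropy of `N` is the only relation between its frame coordinates that is needed.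
  linear_combination (4 * D ^ 2 * (1 + l ^ 2) ^ 2 * ((D + l ^ 2) ^ 2 + (l * (D - 1)) ^ 2)) * hxyz

end IsJoint

end VectorAlgebra
-- Edge directions and binormals of the polyhedral curve.
section Curve

lemma IsJoint.ofReal {C C' W : Fin 3 → ℝ} {l : ℝ} (hC : C ⬝ᵥ C = 1) (hW : W ⬝ᵥ W = 1)
    (h : W ⬝ᵥ C = 0) (hr : (1 + l ^ 2) • C' = (1 - l ^ 2) • C + (2 * l) • (W ⨯₃ C)) :
    IsJoint (fun j => (C j : ℂ)) (fun j => (C' j : ℂ)) (fun j => (W j : ℂ)) (l : ℂ) where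
  unit := by
    simp only [dotProduct] at hC ⊢
    exact_mod_cast hC
  unit_binormal := by
    simp only [dotProduct] at hW ⊢
    exact_mod_cast hW
  orth := by
    simp only [dotProduct] at h ⊢
    exact_mod_cast h
  ne := by
    have : (1 + l ^ 2 : ℝ) ≠ 0 := by positivity
    exact_mod_cast this
  rotate := by
    ext j
    have hj := congrFun hr j
    fin_cases j <;> simp [cross_apply] at hj ⊢ <;> exact_mod_cast hj

variable {n : ℕ} [NeZero n] {V : Fin n → EuclideanSpace ℝ (Fin 3)}

lemma edge_add_one (V : Fin n → EuclideanSpace ℝ (Fin 3)) (i : Fin n) :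
    edge V (i + 1) = V (i + 1) - V i := by
  rw [edge, add_sub_cancel_right]

lemma barLambda_eq (V : Fin n → EuclideanSpace ℝ (Fin 3)) (i : Fin n) :
    barLambda V i = Real.pi - EuclideanGeometry.angle (V (i - 1)) (V i) (V (i + 1)) := by
  rw [barLambda, edge_add_one, edge, EuclideanGeometry.angle, ← InnerProductGeometry.angle_neg_left,
    vsub_eq_sub, vsub_eq_sub, neg_sub]

lemma IsPolyhedralCurve.barLambda_pos (hV : IsPolyhedralCurve V) (i : Fin n) :
    0 < barLambda V i := by
  rw [barLambda_eq, sub_pos]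
  exact lt_of_le_of_ne (EuclideanGeometry.angle_le_pi _ _ _)
    fun h => hV i (EuclideanGeometry.collinear_of_angle_eq_pi h)

lemma IsPolyhedralCurve.barLambda_lt_pi (hV : IsPolyhedralCurve V) (i : Fin n) :
    barLambda V i < Real.pi := by
  rw [barLambda_eq, sub_lt_self_iff]
  exact lt_of_le_of_ne (EuclideanGeometry.angle_nonneg _ _ _)
    fun h => hV i (EuclideanGeometry.collinear_of_angle_eq_zero h.symm)

lemma IsPolyhedralCurve.edge_ne_zero (hV : IsPolyhedralCurve V) (i : Fin n) : edge V i ≠ 0 := by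
  intro h
  refine hV i ?_
  rw [edge, sub_eq_zero] at h
  rw [h, Set.insert_eq_of_mem (by simp)]
  exact collinear_pair ℝ _ _

lemma IsPolyhedralCurve.tan_pos (hV : IsPolyhedralCurve V) (i : Fin n) :
    0 < Real.tan (barLambda V i / 2) :=
  Real.tan_pos_of_pos_of_lt_pi_div_two (by linarith [hV.barLambda_pos i])
    (by linarith [hV.barLambda_lt_pi i])

/-- The positive factor which normalizes the cross product of two consecutive edges. -/
noncomputable def binormalScale (V : Fin n → EuclideanSpace ℝ (Fin 3)) (i : Fin n) : ℝ :=
  (‖edge V i‖ * ‖edge V (i + 1)‖ * Real.sin (barLambda V i))⁻¹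

/-- The unit binormal of the curve at the vertex `i`. -/
noncomputable def realBinormal (V : Fin n → EuclideanSpace ℝ (Fin 3)) (i : Fin n) : Fin 3 → ℝ :=
  binormalScale V i • ((edge V i).ofLp ⨯₃ (edge V (i + 1)).ofLp)

/-- The unit binormal of the curve at the vertex `i`, seen in `ℂ³`. -/
noncomputable def binormal (V : Fin n → EuclideanSpace ℝ (Fin 3)) (i : Fin n) : Fin 3 → ℂ :=
  fun j => (realBinormal V i j : ℂ)

lemma IsPolyhedralCurve.binormalScale_pos (hV : IsPolyhedralCurve V) (i : Fin n) :
    0 < binormalScale V i := by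
  have h1 := norm_pos_iff.2 (hV.edge_ne_zero i)
  have h2 := norm_pos_iff.2 (hV.edge_ne_zero (i + 1))
  have h3 := Real.sin_pos_of_pos_of_lt_pi (hV.barLambda_pos i) (hV.barLambda_lt_pi i)
  rw [binormalScale]
  positivity

lemma ofLp_dotProduct (a b : EuclideanSpace ℝ (Fin 3)) : a.ofLp ⬝ᵥ b.ofLp = inner ℝ a b := by
  rw [dotProduct_comm, EuclideanSpace.inner_eq_star_dotProduct]
  simp

lemma IsPolyhedralCurve.realBinormal_dot_self (hV : IsPolyhedralCurve V) (i : Fin n) :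
    realBinormal V i ⬝ᵥ realBinormal V i = 1 := by
  have h1 := norm_pos_iff.2 (hV.edge_ne_zero i)
  have h2 := norm_pos_iff.2 (hV.edge_ne_zero (i + 1))
  have h3 := Real.sin_pos_of_pos_of_lt_pi (hV.barLambda_pos i) (hV.barLambda_lt_pi i)
  have h4 := Real.sin_sq_add_cos_sq (barLambda V i)
  have h5 : inner ℝ (edge V i) (edge V (i + 1)) = _ :=
    (InnerProductGeometry.cos_angle_mul_norm_mul_norm _ _).symm
  rw [← barLambda] at h5
  rw [realBinormal, binormalScale, smul_dotProduct, dotProduct_smul, cross_dot_cross]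
  simp only [ofLp_dotProduct, real_inner_self_eq_norm_sq, smul_eq_mul]
  rw [real_inner_comm (edge V i), h5]
  field_simp
  linear_combination -h4

/-- Rotation about the normalized cross product through the angle between the edges. It transfers
the real geometry to the complex algebra of joints. -/
lemma IsPolyhedralCurve.isJoint (hV : IsPolyhedralCurve V) (i : Fin n) :
    IsJoint (edgeDir V i) (edgeDir V (i + 1)) (binormal V i) (tanLambda V i) := by
  have h1 := norm_pos_iff.2 (hV.edge_ne_zero i)
  have h2 := norm_pos_iff.2 (hV.edge_ne_zero (i + 1))
  have h3 := Real.sin_pos_of_pos_of_lt_pi (hV.barLambda_pos i) (hV.barLambda_lt_pi i)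
  have h5 : inner ℝ (edge V i) (edge V (i + 1)) = _ :=
    (InnerProductGeometry.cos_angle_mul_norm_mul_norm _ _).symm
  rw [← barLambda] at h5
  have hc : Real.cos (barLambda V i / 2) ≠ 0 :=
    (Real.cos_pos_of_mem_Ioo ⟨by linarith [hV.barLambda_pos i, Real.pi_pos],
      by linarith [hV.barLambda_lt_pi i]⟩).ne'
  have hcos : 1 - Real.tan (barLambda V i / 2) ^ 2 =
      (1 + Real.tan (barLambda V i / 2) ^ 2) * Real.cos (barLambda V i) := by
    have hs := Real.sin_sq_add_cos_sq (barLambda V i / 2)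
    have : Real.cos (barLambda V i) = 2 * Real.cos (barLambda V i / 2) ^ 2 - 1 := by
      rw [← Real.cos_two_mul]; congr 1; ring
    rw [this, Real.tan_eq_sin_div_cos]
    field_simp
    linear_combination (-2 * Real.cos (barLambda V i / 2) ^ 2) * hs
  have hsin : 2 * Real.tan (barLambda V i / 2) =
      (1 + Real.tan (barLambda V i / 2) ^ 2) * Real.sin (barLambda V i) := by
    have hs := Real.sin_sq_add_cos_sq (barLambda V i / 2)
    have : Real.sin (barLambda V i) =
        2 * Real.sin (barLambda V i / 2) * Real.cos (barLambda V i / 2) := by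
      rw [← Real.sin_two_mul]; congr 1; ring
    rw [this, Real.tan_eq_sin_div_cos]
    field_simp
    linear_combination (-Real.sin (barLambda V i / 2)) * hs
  refine IsJoint.ofReal (C := fun j => ‖edge V i‖⁻¹ * edge V i j)
    (C' := fun j => ‖edge V (i + 1)‖⁻¹ * edge V (i + 1) j) (W := realBinormal V i) ?_
    (hV.realBinormal_dot_self i) ?_ ?_
  · change (‖edge V i‖⁻¹ • (edge V i).ofLp) ⬝ᵥ (‖edge V i‖⁻¹ • (edge V i).ofLp) = 1
    rw [smul_dotProduct, dotProduct_smul, ofLp_dotProduct, real_inner_self_eq_norm_sq]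
    simp only [smul_eq_mul]
    field_simp
  · change _ ⬝ᵥ (‖edge V i‖⁻¹ • (edge V i).ofLp) = 0
    rw [realBinormal, smul_dotProduct, dotProduct_smul, dotProduct_comm, dot_self_cross]
    simp
  · change _ • (‖edge V (i + 1)‖⁻¹ • (edge V (i + 1)).ofLp) =
      _ • (‖edge V i‖⁻¹ • (edge V i).ofLp) + _ • (_ ⨯₃ (‖edge V i‖⁻¹ • (edge V i).ofLp))
    have hcr : ((edge V i).ofLp ⨯₃ (edge V (i + 1)).ofLp) ⨯₃ (edge V i).ofLp =
        (‖edge V i‖ ^ 2) • (edge V (i + 1)).ofLp -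
          (Real.cos (barLambda V i) * (‖edge V i‖ * ‖edge V (i + 1)‖)) • (edge V i).ofLp := by
      rw [← h5, ← real_inner_self_eq_norm_sq, ← ofLp_dotProduct, ← ofLp_dotProduct]
      ext j
      fin_cases j <;> simp [cross_apply, dotProduct, Fin.sum_univ_three] <;> ring
    rw [hcos, hsin, realBinormal, binormalScale, map_smul, LinearMap.map_smul₂, hcr]
    ext j
    simp only [Pi.smul_apply, Pi.add_apply, Pi.sub_apply, smul_eq_mul]
    field_simp
    ring

end Curve

/-! ### Cyclic indices. -/

section Cyclic

variable {n : ℕ} [NeZero n]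

/-- Separates ordinary steps around the curve from the closing one, where the closure condition
enters. -/
lemma val_add_one_or (i : Fin n) :
    (i + 1).val = i.val + 1 ∨ (i.val + 1 = n ∧ i + 1 = 0) := by
  obtain ⟨m, rfl⟩ := Nat.exists_eq_succ_of_ne_zero (NeZero.ne n)
  rcases eq_or_ne i (Fin.last m) with rfl | h
  · right; simp
  · left
    exact Fin.val_add_one_of_lt (lt_of_le_of_ne (Fin.le_last i) h)

end Cyclic

/-! ### Planar curves with zero shifts. -/

section Planar

variable {n : ℕ} [NeZero n] {V : Fin n → EuclideanSpace ℝ (Fin 3)}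

lemma exists_normal_of_coplanar (h : Coplanar ℝ (Set.range V)) :
    ∃ w : Fin 3 → ℝ, w ⬝ᵥ w = 1 ∧ ∀ i, w ⬝ᵥ (edge V i).ofLp = 0 := by
  have h2 := h.finrank_le_two
  have h3 := (vectorSpan ℝ (Set.range V)).finrank_add_finrank_orthogonal
  rw [finrank_euclideanSpace, Fintype.card_fin] at h3
  have hne : (vectorSpan ℝ (Set.range V))ᗮ ≠ ⊥ := by
    intro h0
    rw [h0, finrank_bot] at h3
    omega
  obtain ⟨w, hw, hw0⟩ := Submodule.exists_mem_ne_zero_of_ne_bot hne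
  have hn := norm_ne_zero_iff.2 hw0
  refine ⟨‖w‖⁻¹ • w.ofLp, ?_, fun i => ?_⟩
  · rw [smul_dotProduct, dotProduct_smul, ofLp_dotProduct, real_inner_self_eq_norm_sq]
    simp only [smul_eq_mul]
    field_simp
  · rw [smul_dotProduct, ofLp_dotProduct, Submodule.inner_left_of_mem_orthogonal _ hw, smul_zero]
    exact vsub_mem_vectorSpan ℝ (Set.mem_range_self _) (Set.mem_range_self _)

lemma cross_eq_smul_normal {w a b : Fin 3 → ℝ} (hw : w ⬝ᵥ w = 1) (ha : w ⬝ᵥ a = 0)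
    (hb : w ⬝ᵥ b = 0) : a ⨯₃ b = (w ⬝ᵥ (a ⨯₃ b)) • w := by
  have h : w ⨯₃ (w ⨯₃ (a ⨯₃ b)) = 0 := by
    have : w ⨯₃ (a ⨯₃ b) = (w ⬝ᵥ b) • a - (w ⬝ᵥ a) • b := by
      ext j
      fin_cases j <;> simp [cross_apply, dotProduct, Fin.sum_univ_three] <;> ring
    rw [this, ha, hb]
    simp
  have h' : w ⨯₃ (w ⨯₃ (a ⨯₃ b)) = (w ⬝ᵥ (a ⨯₃ b)) • w - (w ⬝ᵥ w) • (a ⨯₃ b) := by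
    generalize a ⨯₃ b = v
    ext j
    fin_cases j <;> simp [cross_apply, dotProduct, Fin.sum_univ_three] <;> ring
  rw [h', hw, one_smul, sub_eq_zero] at h
  exact h.symm

lemma IsPolyhedralCurve.cross_ne_zero (hV : IsPolyhedralCurve V) (i : Fin n) :
    (edge V i).ofLp ⨯₃ (edge V (i + 1)).ofLp ≠ 0 := by
  intro h
  have := hV.realBinormal_dot_self i
  simp [realBinormal, h] at this

/-- Cross products of consecutive edges are nonzero multiples of one unit normal, so their scalar
products are nonzero and `ζ` can record the signs. -/
lemma IsPolyhedralCurve.exists_zeroShifts (hV : IsPolyhedralCurve V)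
    (h : Coplanar ℝ (Set.range V)) : ∃ ζ, ZeroShifts V ζ := by
  obtain ⟨w, hw, hwe⟩ := exists_normal_of_coplanar h
  let X : Fin n → ℝ := fun i => ((edge V (i - 1)).ofLp ⨯₃ (edge V i).ofLp) ⬝ᵥ
      ((edge V i).ofLp ⨯₃ (edge V (i + 1)).ofLp)
  have hX : ∀ i, X i ≠ 0 := by
    intro i
    have h1 := hV.cross_ne_zero (i - 1)
    have h2 := hV.cross_ne_zero i
    rw [sub_add_cancel] at h1
    rw [cross_eq_smul_normal hw (hwe _) (hwe _)] at h1 h2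
    simp only [X]
    rw [cross_eq_smul_normal hw (hwe (i - 1)) (hwe i),
      cross_eq_smul_normal hw (hwe i) (hwe (i + 1)), smul_dotProduct, dotProduct_smul, hw,
      smul_eq_mul, smul_eq_mul, mul_one]
    exact mul_ne_zero (fun h => h1 (by rw [h, zero_smul])) (fun h => h2 (by rw [h, zero_smul]))
  refine ⟨fun i => if 0 < X i then 1 else -1, fun i => ⟨?_, ?_⟩⟩
  · rw [cross_eq_smul_normal hw (hwe (i - 1)) (hwe i), smul_dotProduct, hwe, smul_zero]
  · change 0 < _ * X i
    beta_reduce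
    split_ifs with hi
    · simpa using hi
    · simpa using lt_of_le_of_ne (not_lt.1 hi) (hX i)

lemma intUnit_eq_mul_of_pos {z : ℤˣ} {k k' : ℝ} (hk : k * k = 1) (hk' : k' * k' = 1)
    (h : 0 < ((z : ℤ) : ℝ) * (k * k')) : k' = ((z : ℤ) : ℝ) * k := by
  rcases Int.units_eq_one_or z with rfl | rfl <;>
    rcases mul_self_eq_one_iff.1 hk with rfl | rfl <;>
    rcases mul_self_eq_one_iff.1 hk' with rfl | rfl <;> simp at h ⊢ <;> linarith

/-- Every unit binormal is plus or minus the common normal, and zero shifts say that `ζ` is the sign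
change. -/
lemma IsPolyhedralCurve.binormal_add_one (hV : IsPolyhedralCurve V)
    (h : Coplanar ℝ (Set.range V)) {ζ : Fin n → ℤˣ} (hζ : ZeroShifts V ζ) (i : Fin n) :
    binormal V (i + 1) = ((ζ (i + 1) : ℤ) : ℂ) • binormal V i := by
  obtain ⟨w, hw, hwe⟩ := exists_normal_of_coplanar h
  have hb : ∀ i, ∃ k : ℝ, k * k = 1 ∧ realBinormal V i = k • w := by
    intro i
    have h0 := hV.realBinormal_dot_self i
    have h1 : realBinormal V i =
        (binormalScale V i * (w ⬝ᵥ ((edge V i).ofLp ⨯₃ (edge V (i + 1)).ofLp))) • w := by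
      rw [realBinormal, mul_smul, ← cross_eq_smul_normal hw (hwe _) (hwe _)]
    refine ⟨_, ?_, h1⟩
    rw [h1, smul_dotProduct, dotProduct_smul, hw, smul_eq_mul, smul_eq_mul, mul_one] at h0
    exact h0
  obtain ⟨k, hk, hki⟩ := hb i
  obtain ⟨k', hk', hki'⟩ := hb (i + 1)
  have hz := (hζ (i + 1)).2
  rw [add_sub_cancel_right] at hz
  have hpos : 0 < ((ζ (i + 1) : ℤ) : ℝ) * (k * k') := by
    have h1 := mul_pos (mul_pos (hV.binormalScale_pos i) (hV.binormalScale_pos (i + 1))) hz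
    have h2 : k * k' = realBinormal V i ⬝ᵥ realBinormal V (i + 1) := by
      rw [hki, hki', smul_dotProduct, dotProduct_smul, hw, smul_eq_mul, smul_eq_mul, mul_one]
    rw [h2, realBinormal, realBinormal, smul_dotProduct, dotProduct_smul, smul_eq_mul, smul_eq_mul]
    linarith
  have hkk := intUnit_eq_mul_of_pos hk hk' hpos
  ext j
  simp only [binormal, hki, hki', hkk, Pi.smul_apply, smul_eq_mul]
  push_cast
  ring

lemma one_add_sq_ne_zero {z : ℂ} (hz : ‖z‖ < 1) : 1 + z ^ 2 ≠ 0 := by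
  intro h
  have h1 : z ^ 2 = -1 := by linear_combination h
  have h2 : ‖z‖ ^ 2 = 1 := by rw [← norm_pow, h1]; simp
  nlinarith [norm_nonneg z]

/-- With vanishing shifts, the transmission ratios multiply along a planar curve. -/
lemma IsPolyhedralCurve.isFlexible_of_mem_productOneBelts (hV : IsPolyhedralCurve V)
    (h : Coplanar ℝ (Set.range V)) {ζ : Fin n → ℤˣ} (hζ : ZeroShifts V ζ) {x : BeltParam n}
    (hx : x ∈ productOneBelts V) : IsFlexible V x ζ := by
  obtain ⟨htype, hdeg, f, hf, hprod⟩ := hx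
  -- Half-angle tangent at edge `i` relative to that at edge `0`; the recursion closes up because
  -- the full product is `1`.
  let F : Fin n → ℂ := fun i => ∏ k ∈ Finset.range i.val, f (Fin.ofNat n k)
  have hF0 : F 0 = 1 := by simp [F]
  have hF : ∀ i, F (i + 1) = f i * F i := by
    intro i
    rcases val_add_one_or i with hi | ⟨hi, hi0⟩
    · simp only [F]
      rw [hi, Finset.prod_range_succ, mul_comm, Fin.ofNat_val_eq_self]
    · have h1 : ∏ k ∈ Finset.range n, f (Fin.ofNat n k) = 1 := by
        rw [Finset.prod_range, ← hprod]
        simp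
      have hr : Finset.range n = Finset.range (i.val + 1) := by rw [hi]
      rw [hi0, hF0, ← h1, hr, Finset.prod_range_succ, mul_comm, Fin.ofNat_val_eq_self]
  -- Small enough to keep all half-angle tangents inside the unit disc, away from the poles `±i`.
  let κ : ℝ := (1 + ∑ i, ‖F i‖)⁻¹
  have hsum : 0 ≤ ∑ i, ‖F i‖ := Finset.sum_nonneg fun i _ => norm_nonneg _
  have hκ : 0 < κ := by positivity
  have hs : ∀ t ∈ Set.Icc (0 : ℝ) 1, ∀ i, 1 + (F i * ((κ * t : ℝ) : ℂ)) ^ 2 ≠ 0 := by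
    intro t ht i
    refine one_add_sq_ne_zero ?_
    have h1 : ‖F i‖ ≤ ∑ i, ‖F i‖ :=
      Finset.single_le_sum (f := fun i => ‖F i‖) (fun i _ => norm_nonneg _) (Finset.mem_univ i)
    rw [norm_mul, Complex.norm_real, Real.norm_of_nonneg (mul_nonneg hκ.le ht.1)]
    calc ‖F i‖ * (κ * t) ≤ ‖F i‖ * (κ * 1) := by gcongr; exact ht.2
      _ < 1 := by
        rw [mul_one, ← div_eq_mul_inv, div_lt_one (by positivity)]
        linarith
  refine ⟨fun t i => turn (edgeDir V i) (binormal V i) (F i * ((κ * t : ℝ) : ℂ)), ?_, ?_, ?_⟩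
  · refine continuousOn_pi.2 fun i => ?_
    unfold turn
    have hc : Continuous fun t : ℝ => F i * ((κ * t : ℝ) : ℂ) := by fun_prop
    refine ContinuousOn.add (ContinuousOn.smul (ContinuousOn.div ?_ ?_ fun t ht => hs t ht i)
      continuousOn_const) (ContinuousOn.smul (ContinuousOn.div ?_ ?_ fun t ht => hs t ht i)
      continuousOn_const) <;> exact Continuous.continuousOn (by fun_prop)
  · intro t ht
    have hJ := hV.isJoint
    refine ⟨fun i => turn_dot_self (hJ i).unit (hJ i).unit_binormal (hJ i).orth (hs t ht i),
      fun i => turn_dot (hJ i).orth _, fun i => ?_⟩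
    have hz : ((ζ (i + 1) : ℤ) : ℂ) * ((ζ (i + 1) : ℤ) : ℂ) = 1 := by
      rcases Int.units_eq_one_or (ζ (i + 1)) with h | h <;> simp [h]
    obtain ⟨hm, hg⟩ := htype i
    have hsF := hs t ht (i + 1)
    have hmul : F (i + 1) * ((κ * t : ℝ) : ℂ) = f i * (F i * ((κ * t : ℝ) : ℂ)) := by
      rw [hF, mul_assoc]
    have key := (hJ i).isogram_of_ratio (hf i) (hdeg i).2.1 (hdeg i).2.2 (hs t ht i)
      (by rw [← hmul]; exact hsF)
    simp only [armA, armB]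
    -- The sign from the binormal meets the sign `ζ` in `armB`, and their product is `1`.
    rw [hm, hg, hV.binormal_add_one h hζ i, turn_smul, smul_smul, hmul]
    rw [mul_assoc _ _ ((ζ (i + 1) : ℤ) : ℂ), hz, mul_one]
    linear_combination key
  · intro h01
    -- The component along the binormal vanishes at time `0`, but is `2 κ / (1 + κ ^ 2)` at time
    -- `1`.
    have h1 := congrArg (fun v => v ⬝ᵥ binormal V 0) (congrFun h01 0)
    simp only [turn_dot_binormal (hV.isJoint 0).unit_binormal] at h1
    have h2 := hs 1 (by simp) 0
    have h3 : (κ : ℂ) ≠ 0 := by exact_mod_cast hκ.ne'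
    rw [hF0, one_mul, one_mul, mul_zero, mul_one] at h1
    rw [hF0, one_mul, mul_one] at h2
    rw [Complex.ofReal_zero, mul_zero, zero_div, eq_comm, div_eq_zero_iff] at h1
    rcases h1 with h1 | h1
    · exact mul_ne_zero two_ne_zero h3 h1
    · exact h2 h1

end Planar

/-! ### Complex quaternions acting on `ℂ³`. -/

section QuaternionAction

/-- A vector as a pure quaternion. -/
def toQuat (N : Fin 3 → ℂ) : Quaternion ℂ := ⟨0, N 0, N 1, N 2⟩

/-- The (scaled) rotation `N ↦ Q N Q*` of `ℂ³`. -/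
def act (Q : Quaternion ℂ) (N : Fin 3 → ℂ) : Fin 3 → ℂ :=
  ![(Q * toQuat N * star Q).imI, (Q * toQuat N * star Q).imJ, (Q * toQuat N * star Q).imK]

/-- The quaternion `a + b W`. -/
def jointQuat (W : Fin 3 → ℂ) (a b : ℂ) : Quaternion ℂ := ⟨a, b * W 0, b * W 1, b * W 2⟩

@[simp] lemma re_toQuat (N : Fin 3 → ℂ) : (toQuat N).re = 0 := rfl
@[simp] lemma imI_toQuat (N : Fin 3 → ℂ) : (toQuat N).imI = N 0 := rfl
@[simp] lemma imJ_toQuat (N : Fin 3 → ℂ) : (toQuat N).imJ = N 1 := rfl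
@[simp] lemma imK_toQuat (N : Fin 3 → ℂ) : (toQuat N).imK = N 2 := rfl
@[simp] lemma re_jointQuat (W : Fin 3 → ℂ) (a b : ℂ) : (jointQuat W a b).re = a := rfl
@[simp] lemma imI_jointQuat (W : Fin 3 → ℂ) (a b : ℂ) : (jointQuat W a b).imI = b * W 0 := rfl
@[simp] lemma imJ_jointQuat (W : Fin 3 → ℂ) (a b : ℂ) : (jointQuat W a b).imJ = b * W 1 := rfl
@[simp] lemma imK_jointQuat (W : Fin 3 → ℂ) (a b : ℂ) : (jointQuat W a b).imK = b * W 2 := rfl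

lemma toQuat_injective : Function.Injective toQuat := by
  intro N N' h
  ext j
  fin_cases j
  · exact congrArg QuaternionAlgebra.imI h
  · exact congrArg QuaternionAlgebra.imJ h
  · exact congrArg QuaternionAlgebra.imK h

lemma toQuat_act (Q : Quaternion ℂ) (N : Fin 3 → ℂ) :
    toQuat (act Q N) = Q * toQuat N * star Q := by
  ext
  · simp
    ring
  all_goals rfl

lemma act_mul (P Q : Quaternion ℂ) (N : Fin 3 → ℂ) : act (P * Q) N = act P (act Q N) := by
  apply toQuat_injective
  rw [toQuat_act, toQuat_act, toQuat_act, star_mul]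
  simp only [mul_assoc]

lemma act_one (N : Fin 3 → ℂ) : act 1 N = N := by
  apply toQuat_injective
  rw [toQuat_act]
  simp

/-- Scalar quaternions fix every direction, which is all that closing the chain of isotropic vectors
requires. -/
lemma act_eq_smul {Q : Quaternion ℂ} (hI : Q.imI = 0) (hJ : Q.imJ = 0) (hK : Q.imK = 0)
    (N : Fin 3 → ℂ) : act Q N = (Quaternion.normSq Q) • N := by
  ext j
  rw [Quaternion.normSq_def']
  fin_cases j <;> simp [act, hI, hJ, hK] <;> ring

lemma act_coe_mul_star (Q : Quaternion ℂ) (N : Fin 3 → ℂ) :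
    act Q (act (star Q) N) = (Quaternion.normSq Q ^ 2) • N := by
  rw [← act_mul, Quaternion.self_mul_star, act_eq_smul (by simp) (by simp) (by simp),
    Quaternion.normSq_coe]

lemma act_dot (Q : Quaternion ℂ) (N M : Fin 3 → ℂ) : act Q N ⬝ᵥ M = N ⬝ᵥ act (star Q) M := by
  simp [dotProduct, Fin.sum_univ_three, act]
  ring

lemma act_dot_self (Q : Quaternion ℂ) (N : Fin 3 → ℂ) :
    act Q N ⬝ᵥ act Q N = Quaternion.normSq Q ^ 2 * (N ⬝ᵥ N) := by
  have h := act_coe_mul_star (star Q) N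
  rw [star_star, Quaternion.normSq_star] at h
  rw [act_dot, h, dotProduct_smul, smul_eq_mul]

lemma rot_eq_act {W : Fin 3 → ℂ} (hW : W ⬝ᵥ W = 1) (a b : ℂ) (N : Fin 3 → ℂ) :
    rot W a b N = act (jointQuat W a b) N := by
  simp only [dotProduct, Fin.sum_univ_three] at hW
  ext j
  simp only [rot, Pi.add_apply, Pi.smul_apply, smul_eq_mul]
  fin_cases j <;> simp [act, cross_apply, dotProduct, Fin.sum_univ_three]
  · linear_combination (b ^ 2 * N 0) * hW
  · linear_combination (b ^ 2 * N 1) * hW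
  · linear_combination (b ^ 2 * N 2) * hW

lemma normSq_jointQuat {W : Fin 3 → ℂ} (hW : W ⬝ᵥ W = 1) (a b : ℂ) :
    Quaternion.normSq (jointQuat W a b) = a ^ 2 + b ^ 2 := by
  simp only [dotProduct, Fin.sum_univ_three] at hW
  rw [Quaternion.normSq_def']
  simp only [re_jointQuat, imI_jointQuat, imJ_jointQuat, imK_jointQuat]
  linear_combination b ^ 2 * hW

lemma continuous_act (Q : Quaternion ℂ) : Continuous (act Q) := by
  refine continuous_pi fun j => ?_
  fin_cases j <;> simp [act] <;> fun_prop

/-- The product `q (k - 1) ⋯ q 1 q 0`. -/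
def partialProd {n : ℕ} [NeZero n] (q : Fin n → Quaternion ℂ) : ℕ → Quaternion ℂ
  | 0 => 1
  | k + 1 => q (Fin.ofNat n k) * partialProd q k

lemma normSq_partialProd_ne_zero {n : ℕ} [NeZero n] {q : Fin n → Quaternion ℂ}
    (hq : ∀ i, Quaternion.normSq (q i) ≠ 0) (k : ℕ) : Quaternion.normSq (partialProd q k) ≠ 0 := by
  induction k with
  | zero => simp [partialProd]
  | succ k ih =>
    rw [partialProd, map_mul]
    exact mul_ne_zero (hq _) ih

end QuaternionAction

/-! ### A curve of isotropic directions. -/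

section IsotropicCurve

/-- A parametrization of the isotropic cone. -/
noncomputable def isotropicCurve (t : ℝ) : Fin 3 → ℂ :=
  ![1 - (t : ℂ) ^ 2, Complex.I * (1 + (t : ℂ) ^ 2), -2 * (t : ℂ)]

lemma isotropicCurve_dot_self (t : ℝ) : isotropicCurve t ⬝ᵥ isotropicCurve t = 0 := by
  simp [isotropicCurve, dotProduct, Fin.sum_univ_three]
  linear_combination (1 + (t : ℂ) ^ 2) ^ 2 * Complex.I_sq

lemma continuous_isotropicCurve : Continuous isotropicCurve := by
  refine continuous_pi fun j => ?_
  fin_cases j <;> simp [isotropicCurve] <;> fun_prop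

/-- The pairing is a polynomial of degree at most two in `t` whose coefficients determine `E`. -/
lemma finite_isotropicCurve_dot_eq_zero {E : Fin 3 → ℂ} (hE : E ≠ 0) :
    {t : ℝ | isotropicCurve t ⬝ᵥ E = 0}.Finite := by
  let p : Polynomial ℂ := Polynomial.C (E 0 + Complex.I * E 1) +
    Polynomial.C (-2 * E 2) * Polynomial.X +
    Polynomial.C (Complex.I * E 1 - E 0) * Polynomial.X ^ 2
  have hp : p ≠ 0 := by
    intro h
    have h0 : E 0 + Complex.I * E 1 = 0 := by
      have := congrArg (Polynomial.coeff · 0) h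
      simpa [p] using this
    have h1 : E 2 = 0 := by
      have := congrArg (Polynomial.coeff · 1) h
      simp only [p, Polynomial.coeff_add, Polynomial.coeff_C_mul, Polynomial.coeff_C,
        Polynomial.coeff_X, Polynomial.coeff_X_pow] at this
      simpa using this
    have h2 : Complex.I * E 1 - E 0 = 0 := by
      have := congrArg (Polynomial.coeff · 2) h
      simp only [p, Polynomial.coeff_add, Polynomial.coeff_C_mul, Polynomial.coeff_C,
        Polynomial.coeff_X, Polynomial.coeff_X_pow] at this
      simpa using this
    refine hE (funext fun j => ?_)
    fin_cases j
    · change E 0 = 0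
      linear_combination (h0 - h2) / 2
    · change E 1 = 0
      linear_combination (-Complex.I / 2) * (h0 + h2) + E 1 * Complex.I_sq
    · exact h1
  refine ((Polynomial.finite_setOfPred_isRoot hp).preimage
    (Complex.ofReal_injective.injOn)).subset fun t ht => ?_
  have ht' : isotropicCurve t ⬝ᵥ E = 0 := ht
  simp only [isotropicCurve, dotProduct, Fin.sum_univ_three] at ht'
  simp at ht'
  simp only [p, Set.mem_preimage, Set.mem_ofPred_eq, Polynomial.IsRoot]
  simp
  linear_combination ht'

/-- The first coordinate minus `i` times the second is the constant `2`, which forces `p = q`; the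
third coordinate then recovers the parameter. -/
lemma isotropicCurve_injective_of_smul {a b : ℝ} {p q : ℂ} (hp : p ≠ 0)
    (h : p • isotropicCurve a = q • isotropicCurve b) : a = b := by
  have h0 := congrFun h 0
  have h1 := congrFun h 1
  have h2 := congrFun h 2
  simp [isotropicCurve] at h0 h1 h2
  have hpq : p = q := by
    linear_combination (h0 - Complex.I * h1) / 2 +
      ((p * (1 + (a : ℂ) ^ 2) - q * (1 + (b : ℂ) ^ 2)) / 2) * Complex.I_sq
  rw [← hpq] at h2
  have : (a : ℂ) = b := mul_left_cancel₀ hp (by linear_combination h2 / 2)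
  exact_mod_cast this

lemma exists_segment_of_finite {S : Set ℝ} (hS : S.Finite) :
    ∃ ε > 0, ∀ t ∈ Set.Icc (0 : ℝ) 1, ε * (1 + t) ∉ S := by
  have hcl : (S \ {0})ᶜ ∈ nhds (0 : ℝ) :=
    (hS.subset Set.sdiff_subset).isClosed.isOpen_compl.mem_nhds (by simp)
  obtain ⟨ε, hε, hsub⟩ := Metric.mem_nhds_iff.1 hcl
  refine ⟨ε / 3, by positivity, fun t ht hmem => ?_⟩
  have hpos : 0 < ε / 3 * (1 + t) := by have := ht.1; positivity
  refine hsub (?_ : ε / 3 * (1 + t) ∈ Metric.ball 0 ε) ⟨hmem, hpos.ne'⟩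
  rw [Metric.mem_ball, dist_zero_right, Real.norm_of_nonneg hpos.le]
  nlinarith [ht.2]

end IsotropicCurve

/-! ### Flexibility from a scalar quaternion product. -/

section Flexible

variable {n : ℕ} [NeZero n] {V : Fin n → EuclideanSpace ℝ (Fin 3)}

/-- The rotation of isotropic vectors at the vertex `i`, for the bar length with half-angle
tangent `d i`. -/
noncomputable def vertexQuat (V : Fin n → EuclideanSpace ℝ (Fin 3)) (d : Fin n → ℂ) (i : Fin n) :
    Quaternion ℂ :=
  jointQuat (binormal V i) (-Complex.I * d i + tanLambda V i ^ 2)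
    (tanLambda V i * (-Complex.I * d i - 1))

/-- A belt with isograms of type (1) is flexible if the product of the rotations of isotropic
vectors around the curve is a scalar. -/
lemma IsPolyhedralCurve.isFlexible_of_scalar (hV : IsPolyhedralCurve V) {x : BeltParam n}
    (htype : ∀ i, IsType1At V x i) (hdeg : IsNondegenerate V x)
    (hI : (partialProd (vertexQuat V x.d) n).imI = 0)
    (hJ : (partialProd (vertexQuat V x.d) n).imJ = 0)
    (hK : (partialProd (vertexQuat V x.d) n).imK = 0) : IsFlexible V x 1 := by
  have H := hV.isJoint
  let Q := partialProd (vertexQuat V x.d)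
  -- Each factor has norm `(1 + l ^ 2) (l ^ 2 - d ^ 2)`, nonzero by nondegeneracy.
  have hQ : ∀ k, Quaternion.normSq (Q k) ≠ 0 := by
    refine normSq_partialProd_ne_zero fun i => ?_
    rw [vertexQuat, normSq_jointQuat (H i).unit_binormal]
    have h1 := (hdeg i).2.1
    have h2 := mul_ne_zero (sub_ne_zero.2 h1.symm) (H i).ne
    intro h0
    refine h2 ?_
    linear_combination h0 - (x.d i ^ 2 * (1 + tanLambda V i ^ 2)) * Complex.I_sq
  -- Parameters at which some transported isotropic vector is orthogonal to its edge, so that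
  -- `ofIsotropic` breaks down.
  let bad : Set ℝ := ⋃ i : Fin n, {t | isotropicCurve t ⬝ᵥ act (star (Q i.val)) (edgeDir V i) = 0}
  have hbad : bad.Finite := by
    refine Set.finite_iUnion fun i => finite_isotropicCurve_dot_eq_zero fun h0 => ?_
    have h1 := act_coe_mul_star (Q i.val) (edgeDir V i)
    rw [h0] at h1
    have h2 := congrArg (fun v => v ⬝ᵥ edgeDir V i) h1
    rw [act_dot, zero_dotProduct, smul_dotProduct, (H i).unit, smul_eq_mul, mul_one] at h2
    exact pow_ne_zero 2 (hQ i.val) h2.symm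
  obtain ⟨ε, hε, hseg⟩ := exists_segment_of_finite hbad
  let N : ℝ → Fin n → Fin 3 → ℂ := fun t i => act (Q i.val) (isotropicCurve (ε * (1 + t)))
  have hNC : ∀ t ∈ Set.Icc (0 : ℝ) 1, ∀ i, N t i ⬝ᵥ edgeDir V i ≠ 0 := by
    intro t ht i h0
    refine hseg t ht (Set.mem_iUnion.2 ⟨i, ?_⟩)
    simp only [N, act_dot] at h0
    exact h0
  have hNN : ∀ t i, N t i ⬝ᵥ N t i = 0 := by
    intro t i
    simp only [N]
    rw [act_dot_self, isotropicCurve_dot_self, mul_zero]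
  -- The factor `r` differs from `1` only at the closing vertex, and is harmless since `ofIsotropic`
  -- depends only on the direction.
  have hstep : ∀ t i, ∃ r : ℂ, r ≠ 0 ∧ act (vertexQuat V x.d i) (N t i) = r • N t (i + 1) := by
    intro t i
    have h1 : act (vertexQuat V x.d i) (N t i) =
        act (Q (i.val + 1)) (isotropicCurve (ε * (1 + t))) := by
      simp only [N, Q]
      rw [partialProd, act_mul, Fin.ofNat_val_eq_self]
    rcases val_add_one_or i with hi | ⟨hi, hi0⟩
    · exact ⟨1, one_ne_zero, by rw [h1, one_smul]; simp only [N]; rw [hi]⟩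
    · refine ⟨Quaternion.normSq (Q n), hQ n, ?_⟩
      have h0 : N t (i + 1) = isotropicCurve (ε * (1 + t)) := by
        simp only [N, Q]
        rw [hi0, Fin.val_zero, partialProd, act_one]
      rw [h1, hi, h0, act_eq_smul hI hJ hK]
  refine ⟨fun t i => ofIsotropic (edgeDir V i) (N t i), ?_, fun t ht => ⟨?_, ?_, ?_⟩, ?_⟩
  · refine continuousOn_pi.2 fun i => ?_
    have hc : Continuous fun t => N t i := by
      have := continuous_act (Q i.val)
      have := continuous_isotropicCurve
      simp only [N]
      fun_prop
    have hc' : Continuous fun t => N t i ⬝ᵥ edgeDir V i := by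
      simp only [dotProduct]
      fun_prop
    unfold ofIsotropic
    have hinv : ContinuousOn (fun t => (N t i ⬝ᵥ edgeDir V i)⁻¹) (Set.Icc 0 1) :=
      hc'.continuousOn.inv₀ fun t ht => hNC t ht i
    have hcon := hc.continuousOn (s := Set.Icc 0 1)
    fun_prop
  · exact fun i => ofIsotropic_dot_self (H i).unit (hNN t i) (hNC t ht i)
  · exact fun i => ofIsotropic_dot (H i).unit (hNC t ht i)
  · intro i
    obtain ⟨r, hr, hrN⟩ := hstep t i
    obtain ⟨hm, hg⟩ := htype i
    have key := (H i).isogram_of_isotropic (D := -Complex.I * x.d i) (d := x.d i)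
      (by linear_combination x.d i * Complex.I_sq)
      (rot_eq_act (H i).unit_binormal _ _ (N t i)).symm (hNN t i) (hNC t ht i)
      (by
        change act (vertexQuat V x.d i) (N t i) ⬝ᵥ _ ≠ 0
        rw [hrN, smul_dotProduct]
        exact mul_ne_zero hr (hNC t ht (i + 1)))
    change _ * (_ ⬝ᵥ (_ + _ • ofIsotropic _ (act (vertexQuat V x.d i) (N t i)))) = _ at key
    rw [hrN, ofIsotropic_smul _ _ hr] at key
    simp only [armA, armB]
    rw [hm, hg, Pi.one_apply, Units.val_one, Int.cast_one, mul_one]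
    linear_combination key
  · intro h01
    have h1 := congrFun h01 0
    simp only [ofIsotropic] at h1
    have h2 := sub_right_injective (smul_right_injective _ Complex.I_ne_zero h1)
    have h3 : ∀ t, N t 0 = isotropicCurve (ε * (1 + t)) := by
      intro t
      simp only [N, Q]
      rw [Fin.val_zero, partialProd, act_one]
    have h4 : (N 0 0 ⬝ᵥ edgeDir V 0)⁻¹ ≠ 0 := inv_ne_zero (hNC 0 (by simp) 0)
    rw [h3 0, h3 1] at h2
    rw [h3 0] at h4
    have := isotropicCurve_injective_of_smul h4 h2
    linarith

end Flexible

/-! ### Counting equations and exhibiting solutions. -/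

section Belts

open MvPolynomial

variable {n : ℕ} [NeZero n] {V : Fin n → EuclideanSpace ℝ (Fin 3)}

/-- The coordinates of the belt with isograms of type (1) as polynomials in the half-angle tangents
of the bar lengths `δ i`. -/
noncomputable def beltPoly (V : Fin n → EuclideanSpace ℝ (Fin 3)) (k : Fin n × Fin 3) :
    MvPolynomial (Fin n) ℂ :=
  if k.2 = 2 then C (tanLambda V k.1) else X k.1

/-- The belt with isograms of type (1) and half-angle tangents `d i` of the bar lengths `δ i`. -/
noncomputable def belt (V : Fin n → EuclideanSpace ℝ (Fin 3)) (d : Fin n → ℂ) : BeltParam n :=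
  fun k => aeval d (beltPoly V k)

@[simp]
lemma belt_d (V : Fin n → EuclideanSpace ℝ (Fin 3)) (d : Fin n → ℂ) : (belt V d).d = d := by
  ext i
  simp [BeltParam.d, belt, beltPoly]

lemma isType1At_belt (V : Fin n → EuclideanSpace ℝ (Fin 3)) (d : Fin n → ℂ) (i : Fin n) :
    IsType1At V (belt V d) i := by
  simp [IsType1At, BeltParam.d, BeltParam.g, BeltParam.m, belt, beltPoly]

/-- A set of belts which contains all nondegenerate belts of type (1) that satisfy at most `k`
equations has codimension at most `2n + k`, if there is such a belt. -/
lemma le_algDim_of_belts {S : Set (BeltParam n)} (s : Set (MvPolynomial (Fin n) ℂ)) {k : ℕ}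
    (hk : s.encard ≤ k)
    (hS : ∀ d : Fin n → ℂ, (∀ p ∈ s, aeval d p = 0) → IsNondegenerate V (belt V d) →
      belt V d ∈ S)
    (d : Fin n → ℂ) (hd : ∀ p ∈ s, aeval d p = 0) (hd' : IsNondegenerate V (belt V d)) :
    ((n - k : ℕ) : WithBot ℕ∞) ≤ algDim S := by
  -- One inequation that encodes nondegeneracy at all vertices.
  let h : MvPolynomial (Fin n) ℂ := ∏ i, (X i * (X i ^ 2 - C (tanLambda V i ^ 2)) *
    (X i ^ 2 * C (tanLambda V i ^ 2) - 1))
  have hh : ∀ d : Fin n → ℂ, aeval d h ≠ 0 ↔ IsNondegenerate V (belt V d) := by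
    intro d
    simp only [h, map_prod, Finset.prod_ne_zero_iff, Finset.mem_univ, true_imp_iff,
      IsNondegenerate, belt_d]
    refine forall_congr' fun i => ?_
    simp only [map_mul, map_sub, map_pow, aeval_X, map_one, aeval_C, Algebra.algebraMap_self,
      RingHom.id_apply, mul_ne_zero_iff, sub_ne_zero, and_assoc]
  have h1 := le_algDim_of_mem s h d hd ((hh d).2 hd')
  have h2 := (algDim_le_algDim_image (beltPoly V) (fun i => (i, 0)) (by simp [beltPoly])
    {y : Fin n → ℂ | (∀ p ∈ s, aeval y p = 0) ∧ aeval y h ≠ 0}).trans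
    (algDim_mono (T := S) (by
      rintro _ ⟨y, hy, rfl⟩
      exact hS y hy.1 ((hh y).1 hy.2)))
  have h3 : (n : WithBot ℕ∞) ≤ algDim S + (k : ℕ∞) := by
    rw [Nat.card_fin] at h1
    refine h1.trans (add_le_add h2 ?_)
    exact_mod_cast hk
  cases hA : algDim S with
  | bot => rw [hA] at h3; simp at h3
  | coe a =>
    rw [hA] at h3
    have h4 : (n : ℕ∞) ≤ a + k := by exact_mod_cast h3
    have h5 : ((n - k : ℕ) : ℕ∞) ≤ a := by
      rw [ENat.natCast_sub]
      exact tsub_le_iff_right.2 h4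
    exact WithBot.coe_le_coe.2 h5

/-- Each factor is affine in one `d i`, so the closure condition consists of polynomial equations.
-/
lemma exists_partialProd_eq_aeval (V : Fin n → EuclideanSpace ℝ (Fin 3)) (k : ℕ) :
    ∃ p₀ p₁ p₂ p₃ : MvPolynomial (Fin n) ℂ, ∀ d : Fin n → ℂ,
      partialProd (vertexQuat V d) k = ⟨aeval d p₀, aeval d p₁, aeval d p₂, aeval d p₃⟩ := by
  induction k with
  | zero => exact ⟨1, 0, 0, 0, fun d => by ext <;> simp <;> rfl⟩
  | succ k ih =>
    obtain ⟨p₀, p₁, p₂, p₃, hp⟩ := ih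
    set i := Fin.ofNat n k with hi
    let a : MvPolynomial (Fin n) ℂ := C (-Complex.I) * X i + C (tanLambda V i ^ 2)
    let b : MvPolynomial (Fin n) ℂ := C (tanLambda V i) * (C (-Complex.I) * X i - 1)
    let W : Fin 3 → MvPolynomial (Fin n) ℂ := fun j => b * C (binormal V i j)
    refine ⟨a * p₀ - W 0 * p₁ - W 1 * p₂ - W 2 * p₃, a * p₁ + W 0 * p₀ + W 1 * p₃ - W 2 * p₂,
      a * p₂ - W 0 * p₃ + W 1 * p₀ + W 2 * p₁, a * p₃ + W 0 * p₂ - W 1 * p₁ + W 2 * p₀,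
      fun d => ?_⟩
    have h0 := congrArg QuaternionAlgebra.re (hp d)
    have h1 := congrArg QuaternionAlgebra.imI (hp d)
    have h2 := congrArg QuaternionAlgebra.imJ (hp d)
    have h3 := congrArg QuaternionAlgebra.imK (hp d)
    dsimp only at h0 h1 h2 h3
    rw [partialProd, ← hi]
    ext <;> simp [vertexQuat, h0, h1, h2, h3, a, b, W]

lemma le_algDim_flexibleIsogonalBelts (hV : IsPolyhedralCurve V) :
    ((n - 3 : ℕ) : WithBot ℕ∞) ≤ algDim (flexibleIsogonalBelts V) := by
  obtain ⟨p₀, p₁, p₂, p₃, hp⟩ := exists_partialProd_eq_aeval V n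
  have hl := fun i => (hV.isJoint i).ne
  -- At `d = i`, that is `D = 1`, each quaternion is the scalar `1 + l ^ 2`; the isograms are
  -- nondegenerate because `l` is real.
  refine le_algDim_of_belts (V := V) (k := 3) {p₁, p₂, p₃} ?_ ?_ (fun _ => Complex.I) ?_ ?_
  · exact (Set.encard_insert_le _ _).trans
      (by grw [Set.encard_insert_le, Set.encard_singleton]; norm_num)
  · intro d hd hdeg
    refine ⟨fun i => Or.inl (isType1At_belt V d i), hdeg, 1,
      hV.isFlexible_of_scalar (isType1At_belt V d) hdeg ?_ ?_ ?_⟩ <;> rw [belt_d, hp]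
    · exact hd p₁ (by simp)
    · exact hd p₂ (by simp)
    · exact hd p₃ (by simp)
  · have hq : ∀ k, (partialProd (vertexQuat V fun _ => Complex.I) k).imI = 0 ∧
        (partialProd (vertexQuat V fun _ => Complex.I) k).imJ = 0 ∧
        (partialProd (vertexQuat V fun _ => Complex.I) k).imK = 0 := by
      intro k
      induction k with
      | zero => exact ⟨rfl, rfl, rfl⟩
      | succ k ih =>
        obtain ⟨h1, h2, h3⟩ := ih
        simp [partialProd, vertexQuat, h1, h2, h3]
    obtain ⟨h1, h2, h3⟩ := hq n
    rw [hp] at h1 h2 h3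
    rintro p (rfl | rfl | rfl)
    exacts [h1, h2, h3]
  · intro i
    rw [belt_d]
    refine ⟨Complex.I_ne_zero, fun h => hl i ?_, fun h => hl i ?_⟩
    · rw [← h, Complex.I_sq]; ring
    · rw [Complex.I_sq] at h
      linear_combination -h

lemma exists_ratio_pow_eq_one (hn : 3 ≤ n) :
    ∃ r : ℝ, r ≠ 0 ∧ (-Complex.I * r + 1) ^ n = (-Complex.I * r - 1) ^ n := by
  have hn0 : (n : ℝ) ≠ 0 := by exact_mod_cast (NeZero.ne n)
  have hn3 : (3 : ℝ) ≤ n := by exact_mod_cast hn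
  set θ : ℝ := Real.pi / n with hθ
  have hpos : 0 < θ := by have := Real.pi_pos; positivity
  have hlt : θ < Real.pi / 2 := by
    rw [hθ]
    exact div_lt_div_of_pos_left Real.pi_pos (by norm_num) (by linarith)
  have hs := Real.sin_pos_of_pos_of_lt_pi hpos (by linarith)
  have hc := Real.cos_pos_of_mem_Ioo ⟨by linarith, hlt⟩
  -- With `r = cot (π / n)` the quotient of the two bases is `exp (2 π i / n)`; `n ≥ 3` makes `r`
  -- nonzero.
  refine ⟨Real.cos θ / Real.sin θ, (div_pos hc hs).ne', ?_⟩
  have hsc : ((Real.sin θ : ℝ) : ℂ) ≠ 0 := by exact_mod_cast hs.ne'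
  have hnθ : (n : ℂ) * θ = Real.pi := by
    have : (n : ℝ) * θ = Real.pi := by rw [hθ]; field_simp
    exact_mod_cast this
  have h1 : -Complex.I * ((Real.cos θ / Real.sin θ : ℝ) : ℂ) + 1 =
      (-Complex.I / Real.sin θ) * Complex.exp (θ * Complex.I) := by
    rw [Complex.exp_mul_I, ← Complex.ofReal_cos, ← Complex.ofReal_sin]
    push_cast at hsc ⊢
    field_simp
    linear_combination (Complex.sin θ) * Complex.I_sq
  have h2 : -Complex.I * ((Real.cos θ / Real.sin θ : ℝ) : ℂ) - 1 =
      (-Complex.I / Real.sin θ) * Complex.exp (-θ * Complex.I) := by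
    rw [Complex.exp_mul_I, Complex.cos_neg, Complex.sin_neg, ← Complex.ofReal_cos,
      ← Complex.ofReal_sin]
    push_cast at hsc ⊢
    field_simp
    linear_combination (-Complex.sin θ) * Complex.I_sq
  rw [h1, h2, mul_pow, mul_pow, ← Complex.exp_nat_mul, ← Complex.exp_nat_mul, ← mul_assoc,
    ← mul_assoc, mul_neg, hnθ, neg_mul, Complex.exp_neg, Complex.exp_pi_mul_I, inv_neg, inv_one]

lemma le_algDim_productOneBelts (hn : 3 ≤ n) (hV : IsPolyhedralCurve V) :
    ((n - 1 : ℕ) : WithBot ℕ∞) ≤ algDim (productOneBelts V) := by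
  obtain ⟨r, hr, hrn⟩ := exists_ratio_pow_eq_one hn
  -- Product one for the ratios `(d + l) / (d - l)`, with denominators cleared. Taking `d i`
  -- proportional to `l i` makes all ratios equal to one `n`-th root of unity, and the imaginary
  -- factor makes `d i ^ 2` negative, hence nondegenerate.
  refine le_algDim_of_belts (V := V) (k := 1)
    {∏ i, (X i + C (tanLambda V i)) - ∏ i, (X i - C (tanLambda V i))} (by simp) ?_
    (fun i => -Complex.I * r * tanLambda V i) ?_ ?_
  · intro d hd hdeg
    have hd' := hd _ rfl
    simp only [map_sub, map_prod, map_add, aeval_X, aeval_C, Algebra.algebraMap_self,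
      RingHom.id_apply, sub_eq_zero] at hd'
    have hne : ∏ i, (d i - tanLambda V i) ≠ 0 := by
      refine Finset.prod_ne_zero_iff.2 fun i _ h0 => (hdeg i).2.1 ?_
      rw [belt_d, sub_eq_zero.1 h0]
    refine ⟨isType1At_belt V d, hdeg,
      fun i => (d i + tanLambda V i) / (d i - tanLambda V i), fun i => Or.inl ?_, ?_⟩
    · rw [belt_d]
    · rw [Finset.prod_div_distrib, hd', div_self hne]
  · rintro p rfl
    simp only [map_sub, map_prod, map_add, aeval_X, aeval_C, Algebra.algebraMap_self,
      RingHom.id_apply, sub_eq_zero]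
    have h1 : ∀ i, -Complex.I * r * tanLambda V i + tanLambda V i =
        (-Complex.I * r + 1) * tanLambda V i := fun i => by ring
    have h2 : ∀ i, -Complex.I * r * tanLambda V i - tanLambda V i =
        (-Complex.I * r - 1) * tanLambda V i := fun i => by ring
    simp only [h1, h2, Finset.prod_mul_distrib, Finset.prod_const, Finset.card_univ,
      Fintype.card_fin, hrn]
  · intro i
    rw [belt_d]
    have ht := hV.tan_pos i
    rw [tanLambda]
    set l := Real.tan (barLambda V i / 2)
    have hlc : (l : ℂ) ≠ 0 := by exact_mod_cast ht.ne'
    have hrc : (r : ℂ) ≠ 0 := by exact_mod_cast hr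
    have hsq : (-Complex.I * r * l) ^ 2 = ((-(r * l) ^ 2 : ℝ) : ℂ) := by
      push_cast
      linear_combination ((r : ℂ) * l) ^ 2 * Complex.I_sq
    refine ⟨mul_ne_zero (mul_ne_zero (neg_ne_zero.2 Complex.I_ne_zero) hrc) hlc, ?_, ?_⟩
    · rw [hsq]
      intro h
      have h' : -(r * l) ^ 2 = l ^ 2 := by exact_mod_cast h
      nlinarith [sq_nonneg (r * l), pow_pos ht 2]
    · rw [hsq]
      intro h
      have h' : -(r * l) ^ 2 * l ^ 2 = 1 := by exact_mod_cast h
      nlinarith [mul_nonneg (sq_nonneg (r * l)) (sq_nonneg l)]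

end Belts

end Kokotsakis

theorem theorem2 (n : ℕ) [NeZero n] (hn : 3 ≤ n) (V : Fin n → EuclideanSpace ℝ (Fin 3))
    (hV : Kokotsakis.IsPolyhedralCurve V) :
    (3 < n → ((n - 3 : ℕ) : WithBot ℕ∞) ≤ Kokotsakis.algDim (Kokotsakis.flexibleIsogonalBelts V)) ∧
    (n = 3 → Coplanar ℝ (Set.range V)) ∧
    (Coplanar ℝ (Set.range V) →
      ((n - 1 : ℕ) : WithBot ℕ∞) ≤ Kokotsakis.algDim (Kokotsakis.flexibleIsogonalBelts V) ∧
      ((n - 1 : ℕ) : WithBot ℕ∞) ≤ Kokotsakis.algDim (Kokotsakis.productOneBelts V) ∧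
      ∃ ζ : Fin n → ℤˣ, Kokotsakis.ZeroShifts V ζ ∧
        ∀ x ∈ Kokotsakis.productOneBelts V, Kokotsakis.IsFlexible V x ζ) := by
  refine ⟨fun _ => Kokotsakis.le_algDim_flexibleIsogonalBelts hV, ?_, fun h => ?_⟩
  · rintro rfl
    have : Set.range V = {V 0, V 1, V 2} := by
      ext v
      simp [Fin.exists_fin_succ, eq_comm]
    rw [this]
    exact coplanar_triple ℝ _ _ _
  · obtain ⟨ζ, hζ⟩ := hV.exists_zeroShifts h
    have hflex := fun x hx => hV.isFlexible_of_mem_productOneBelts h hζ (x := x) hx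
    have hdim := Kokotsakis.le_algDim_productOneBelts hn hV
    exact ⟨hdim.trans (Kokotsakis.algDim_mono fun x hx =>
      ⟨fun i => Or.inl (hx.1 i), hx.2.1, ζ, hflex x hx⟩), hdim, ζ, hζ, hflex⟩
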